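/- For a positive integer $n$, a \emph{well-behaved covering polyhedron} in $\mathbb{R}^n$ is a set of the form $P=\{x\in\mathbb{R}^n_+ \mid Ax\ge b\}$ with rational data $A\in\mathbb{Q}_+^{m\times n}$, $b\in\mathbb{Q}_+^m$ satisfying $A_{ij}\le b_i$ for all $i,j$. For $(\pi,\pi_0)\in\mathbb{Z}^n\times\mathbb{Z}$ let $S(\pi,\pi_0)=\{x\in\mathbb{R}^n \mid \pi_0<\pi^\top x<\pi_0+1\}$, and define the \emph{split closure} of $Q\subseteq\mathbb{R}^n$ by $$\mathcal{S}(Q)=\bigcap_{(\pi,\pi_0)\in\mathbb{Z}^n\times\mathbb{Z}}\operatorname{conv}\bigl(Q\setminus S(\pi,\pi_0)\bigr).$$ \textbf{Theorem.} Let $P_C$ be a well-behaved covering polyhedron. Then (i) $\mathcal{S}(P_C)$ is a well-behaved covering polyhedron; (ii) $2\,P_C\subseteq\mathcal{S}(P_C)$, equivalently $P_C\subseteq\frac12\,\mathcal{S}(P_C)$, where $\alpha P=\{\alpha x\mid x\in P\}$. Moreover, the factor in (ii) is tight: for every $\epsilon>0$ there exist a dimension $n$ and a well-behaved covering polyhedron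 $\tilde P_C\subseteq\mathbb{R}^n$ such that $(2-\epsilon)\,\tilde P_C\not\subseteq\mathcal{S}(\tilde P_C)$. -/

import Mathlib

open scoped Pointwise

/-- The covering polyhedron `{x ∈ ℝⁿ₊ | A x ≥ b}` given by rational data `(A, b)`. -/
def coveringPolyhedron {m n : ℕ} (A : Matrix (Fin m) (Fin n) ℚ) (b : Fin m → ℚ) :
    Set (Fin n → ℝ) :=
  {x | (∀ j, 0 ≤ x j) ∧ ∀ i, (b i : ℝ) ≤ ∑ j, (A i j : ℝ) * x j}

/-- `P` is a well-behaved covering polyhedron: `P = {x ∈ ℝⁿ₊ | A x ≥ b}` for some nonnegative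
rational data `(A, b)` with `A i j ≤ b i` for all `i`, `j`. -/
def IsWellBehavedCovering {n : ℕ} (P : Set (Fin n → ℝ)) : Prop :=
  ∃ (m : ℕ) (A : Matrix (Fin m) (Fin n) ℚ) (b : Fin m → ℚ),
    (∀ i j, 0 ≤ A i j) ∧ (∀ i, 0 ≤ b i) ∧ (∀ i j, A i j ≤ b i) ∧
    P = coveringPolyhedron A b

/-- The split set `{x ∈ ℝⁿ | π₀ < πᵀ x < π₀ + 1}`. -/
def splitSet {n : ℕ} (p : Fin n → ℤ) (p₀ : ℤ) : Set (Fin n → ℝ) :=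
  {x | (p₀ : ℝ) < ∑ j, (p j : ℝ) * x j ∧ ∑ j, (p j : ℝ) * x j < (p₀ : ℝ) + 1}

/-- The split closure: the intersection of `conv (Q \ S)` over all split sets `S`. -/
def splitClosure {n : ℕ} (Q : Set (Fin n → ℝ)) : Set (Fin n → ℝ) :=
  ⋂ (p : Fin n → ℤ) (p₀ : ℤ), convexHull ℝ (Q \ splitSet p p₀)

/-! For (i), each hull `conv (P \ S)` of a covering polyhedron is again an upper set cut out by
finitely many integer covering inequalities. This follows from Weyl and Minkowski duality for the
homogenized cones of the two sides of the split, with the coordinate directions added.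

Finitely many splits suffice. Fix integer generators of the cone over `P`, and record for each split
where every generator lies relative to it. If one split is recorded below another componentwise, its
hull is contained in the other's (`convexHull_diff_splitSet_subset`). The records are tuples of
natural numbers of fixed length, so by Dickson's lemma finitely many minimal ones dominate all
others.

It remains to make the inequalities well-behaved. If `a ⬝ᵥ x ≥ β` is valid outside one split, its
version with coefficients clipped at `β` is valid outside a modified split
(`le_min_dotProduct_of_mem_splitClosure`). The reason is that well-behavedness allows dropping
coordinates of total size `s < 1` at the cost of rescaling by `1 / (1 - s)`. On the orthant clipping
only strengthens an inequality, so the clipped system describes the closure exactly.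

For (ii), a split can matter only if it contains both `x` and `2x`, which up to symmetry forces `p₀
= 0`. The same dropping operation then gives a point of the hull below `2x`. Tightness comes from
the inequalities `∑_{j ≠ i} x_j ≥ 1` and the split `1 < ∑ x_j < 2`. -/

/-! ### Integer cones and Fourier–Motzkin elimination -/

/-- The real vector with the entries of an integer vector. -/
def intVec {ι : Type*} (v : ι → ℤ) : ι → ℝ := fun i => (v i : ℝ)

/-- The real convex cone generated by a set of integer vectors. -/
def intCone {ι : Type*} (G : Set (ι → ℤ)) : Submodule NNReal (ι → ℝ) :=
  Submodule.span NNReal (intVec '' G)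

/-- The real polyhedral cone cut out by a set of integer functionals. -/
def intDual {ι : Type*} [Fintype ι] (H : Set (ι → ℤ)) : Set (ι → ℝ) :=
  {x | ∀ h ∈ H, 0 ≤ intVec h ⬝ᵥ x}

lemma intVec_dotProduct_intVec {ι : Type*} [Fintype ι] (v w : ι → ℤ) :
    intVec v ⬝ᵥ intVec w = ((v ⬝ᵥ w : ℤ) : ℝ) := by
  simp [intVec, dotProduct]

lemma intVec_mem_intCone {ι : Type*} {G : Set (ι → ℤ)} {g : ι → ℤ} (hg : g ∈ G) :
    intVec g ∈ intCone G :=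
  Submodule.subset_span ⟨g, hg, rfl⟩

/-- A linear functional that is nonnegative on the generators is nonnegative on the cone. -/
lemma dotProduct_nonneg_of_mem_intCone {ι : Type*} [Fintype ι] {G : Set (ι → ℤ)} {a x : ι → ℝ}
    (ha : ∀ g ∈ G, 0 ≤ a ⬝ᵥ intVec g) (hx : x ∈ intCone G) : 0 ≤ a ⬝ᵥ x := by
  induction hx using Submodule.span_induction with
  | mem x hx => obtain ⟨g, hg, rfl⟩ := hx; exact ha g hg
  | zero => simp
  | add x y _ _ hx hy => rw [dotProduct_add]; exact add_nonneg hx hy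
  | smul c x _ hx =>
    rw [NNReal.smul_def, dotProduct_smul]
    exact mul_nonneg c.2 hx

/-- Fourier–Motzkin elimination of one nonnegative variable from finitely many inequalities. -/
lemma exists_nonneg_forall_mul_le_iff {α : Type*} {H : Set α} (hH : H.Finite) (p q : α → ℝ) :
    (∃ t : ℝ, 0 ≤ t ∧ ∀ h ∈ H, t * q h ≤ p h) ↔
      (∀ h ∈ H, 0 ≤ q h → 0 ≤ p h) ∧
        ∀ h ∈ H, ∀ k ∈ H, q h < 0 → 0 < q k → 0 ≤ q k * p h - q h * p k := by
  constructor
  · rintro ⟨t, ht, h⟩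
    refine ⟨fun k hk hq => (mul_nonneg ht hq).trans (h k hk), fun i hi k hk hq hq' => ?_⟩
    nlinarith [mul_le_mul_of_nonneg_left (h i hi) hq'.le,
      mul_le_mul_of_nonneg_left (h k hk) (neg_pos.2 hq).le]
  · rintro ⟨h1, h2⟩
    by_cases hk : ∃ k ∈ H, 0 < q k
    · obtain ⟨k, ⟨hkH, hk0⟩, hmin⟩ := Set.exists_min_image {k ∈ H | 0 < q k}
        (fun k => p k / q k) (hH.subset (Set.sep_subset _ _)) hk
      refine ⟨p k / q k, div_nonneg (h1 k hkH hk0.le) hk0.le, fun h hh => ?_⟩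
      rcases lt_trichotomy (q h) 0 with hq | hq | hq
      · rw [div_mul_eq_mul_div, div_le_iff₀ hk0]
        linarith [h2 h hh k hkH hq hk0]
      · rw [hq, mul_zero]
        exact h1 h hh hq.ge
      · exact (le_div_iff₀ hq).1 (hmin h ⟨hh, hq⟩)
    · push Not at hk
      obtain ⟨B, hB⟩ := (hH.image (fun h => p h / q h)).bddAbove
      refine ⟨max B 0, le_max_right _ _, fun h hh => ?_⟩
      rcases (hk h hh).lt_or_eq with hq | hq
      · exact (div_le_iff_of_neg hq).1 ((hB ⟨h, hh, rfl⟩).trans (le_max_left _ _))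
      · rw [hq, mul_zero]
        exact h1 h hh hq.ge

lemma mem_intCone_insert {ι : Type*} {G : Set (ι → ℤ)} {g : ι → ℤ} {x : ι → ℝ} :
    x ∈ intCone (insert g G) ↔ ∃ t : ℝ, 0 ≤ t ∧ x - t • intVec g ∈ intCone G := by
  rw [intCone, Set.image_insert_eq, Submodule.mem_span_insert]
  constructor
  · rintro ⟨a, z, hz, rfl⟩
    refine ⟨a, a.2, ?_⟩
    rwa [NNReal.smul_def, add_sub_cancel_left]
  · rintro ⟨t, ht, h⟩
    refine ⟨t.toNNReal, _, h, ?_⟩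
    rw [NNReal.smul_def, Real.coe_toNNReal t ht, add_sub_cancel]

/-- **Weyl's theorem**: a cone generated by finitely many integer vectors is cut out by finitely
many integer functionals. -/
theorem exists_intDual_eq_intCone {ι : Type*} [Fintype ι] [DecidableEq ι] {G : Set (ι → ℤ)}
    (hG : G.Finite) : ∃ H : Set (ι → ℤ), H.Finite ∧ intDual H = intCone G := by
  induction G, hG using Set.Finite.induction_on with
  | empty =>
    refine ⟨Set.range (fun i => Pi.single i 1) ∪ Set.range (fun i => -Pi.single i 1),
      (Set.finite_range _).union (Set.finite_range _), ?_⟩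
    ext x
    have key : ∀ i, intVec (Pi.single i 1) ⬝ᵥ x = x i := fun i => by
      have : intVec (Pi.single i 1 : ι → ℤ) = Pi.single i 1 := by
        ext j; rcases eq_or_ne j i with rfl | h <;> simp [intVec, *]
      rw [this, single_one_dotProduct]
    have key' : ∀ i, intVec (-Pi.single i 1) ⬝ᵥ x = -x i := fun i => by
      rw [← key, ← neg_dotProduct]; congr 1; ext j; simp [intVec]
    simp only [intDual, Set.mem_ofPred_eq, intCone, Set.image_empty, Submodule.span_empty,
      SetLike.mem_coe, Submodule.mem_bot]
    constructor
    · intro h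
      ext i
      have h1 := h _ (Or.inl ⟨i, rfl⟩)
      have h2 := h _ (Or.inr ⟨i, rfl⟩)
      simp only [key, key'] at h1 h2
      simp only [Pi.zero_apply]
      linarith
    · rintro rfl h -
      simp
  | @insert g G _ hG ih =>
    obtain ⟨H, hH, e⟩ := ih
    -- A new generator `g` adds one nonnegative variable, its coefficient. Eliminating it keeps the
    -- functionals nonnegative at `g` and pairs each negative one with each positive one so that the
    -- values at `g` cancel.
    refine ⟨{h ∈ H | 0 ≤ h ⬝ᵥ g} ∪ (fun w : (ι → ℤ) × (ι → ℤ) =>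
      (w.2 ⬝ᵥ g) • w.1 - (w.1 ⬝ᵥ g) • w.2) '' ({h ∈ H | h ⬝ᵥ g < 0} ×ˢ {k ∈ H | 0 < k ⬝ᵥ g}),
      (hH.subset (Set.sep_subset _ _)).union (((hH.subset (Set.sep_subset _ _)).prod
        (hH.subset (Set.sep_subset _ _))).image _), ?_⟩
    ext x
    have hx : x ∈ intCone (insert g G) ↔
        ∃ t : ℝ, 0 ≤ t ∧ ∀ h ∈ H, t * ((h ⬝ᵥ g : ℤ) : ℝ) ≤ intVec h ⬝ᵥ x := by
      rw [mem_intCone_insert]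
      refine exists_congr fun t => and_congr_right fun _ => ?_
      rw [← SetLike.mem_coe, ← e]
      refine forall₂_congr fun h _ => ?_
      rw [dotProduct_sub, dotProduct_smul, intVec_dotProduct_intVec, sub_nonneg, smul_eq_mul]
    rw [SetLike.mem_coe, hx, exists_nonneg_forall_mul_le_iff hH]
    have hcomb : ∀ h k : ι → ℤ, intVec ((k ⬝ᵥ g) • h - (h ⬝ᵥ g) • k) ⬝ᵥ x =
        ((k ⬝ᵥ g : ℤ) : ℝ) * (intVec h ⬝ᵥ x) - ((h ⬝ᵥ g : ℤ) : ℝ) * (intVec k ⬝ᵥ x) := by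
      intro h k
      rw [← smul_eq_mul, ← smul_eq_mul, ← smul_dotProduct, ← smul_dotProduct, ← sub_dotProduct]
      congr 1
      ext i
      simp [intVec]
    constructor
    · intro hx
      refine ⟨fun h hh hq => hx h (Or.inl ⟨hh, by exact_mod_cast hq⟩), fun h hh k hk hq hq' => ?_⟩
      rw [← hcomb]
      exact hx _ (Or.inr ⟨(h, k), ⟨⟨hh, by exact_mod_cast hq⟩, ⟨hk, by exact_mod_cast hq'⟩⟩, rfl⟩)
    · rintro ⟨h1, h2⟩ _ (⟨hh, hq⟩ | ⟨⟨h, k⟩, ⟨⟨hh, hq⟩, ⟨hk, hq'⟩⟩, rfl⟩)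
      · exact h1 _ hh (by exact_mod_cast hq)
      · simp only [hcomb]
        exact h2 h hh k hk (by exact_mod_cast hq) (by exact_mod_cast hq')

/-- **Minkowski's theorem**: a cone cut out by finitely many integer functionals is generated by
finitely many integer vectors. -/
theorem exists_intCone_eq_intDual {ι : Type*} [Fintype ι] [DecidableEq ι] {H : Set (ι → ℤ)}
    (hH : H.Finite) : ∃ G : Set (ι → ℤ), G.Finite ∧ (intCone G : Set (ι → ℝ)) = intDual H := by
  -- Weyl's theorem is applied twice: the generators sought are the functionals that cut out the
  -- cone spanned by `H`.
  obtain ⟨G, hG, hGH⟩ := exists_intDual_eq_intCone hH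
  obtain ⟨K, -, hKG⟩ := exists_intDual_eq_intCone hG
  refine ⟨G, hG, Set.Subset.antisymm (fun x hx h hh => ?_) fun x hx => ?_⟩
  · refine dotProduct_nonneg_of_mem_intCone (fun g hg => ?_) hx
    have : intVec h ∈ intDual G := by rw [hGH]; exact intVec_mem_intCone hh
    rw [dotProduct_comm]
    exact this g hg
  · rw [← hKG]
    intro k hk
    have : intVec k ∈ intDual G := fun g hg => by
      have h2 : intVec g ∈ intDual K := by rw [hKG]; exact intVec_mem_intCone hg
      rw [dotProduct_comm]
      exact h2 k hk
    rw [hGH] at this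
    rw [dotProduct_comm]
    exact dotProduct_nonneg_of_mem_intCone (fun h hh => by rw [dotProduct_comm]; exact hx h hh) this

/-- A map into a well-quasi-order has a finite set of arguments below all values. -/
lemma exists_finite_forall_exists_le {α β : Type*} [PartialOrder β] [WellQuasiOrderedLE β]
    (f : α → β) : ∃ T : Set α, T.Finite ∧ ∀ a, ∃ t ∈ T, f t ≤ f a := by
  have hfin : {b | Minimal (· ∈ Set.range f) b}.Finite :=
    WellQuasiOrderedLE.finite_of_isAntichain (setOfPred_minimal_antichain _)
  obtain ⟨T, hT⟩ : ∃ T : Set α, T.Finite ∧ f '' T = {b | Minimal (· ∈ Set.range f) b} := by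
    obtain ⟨T, -, hT, e⟩ := Set.exists_subset_image_finite_and
      (f := f) (s := Set.univ) (p := fun t => t = {b | Minimal (· ∈ Set.range f) b}) |>.1
      ⟨_, by rw [Set.image_univ]; exact fun b hb => hb.1, hfin, rfl⟩
    exact ⟨T, hT, e⟩
  refine ⟨T, hT.1, fun a => ?_⟩
  obtain ⟨b, hb, hmin⟩ := exists_minimal_le_of_wellFoundedLT (· ∈ Set.range f) (f a) ⟨a, rfl⟩
  obtain ⟨t, ht, rfl⟩ : b ∈ f '' T := by rw [hT.2]; exact hmin
  exact ⟨t, ht, hb⟩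

/-! ### Covering polyhedra and their homogenization -/

lemma mem_splitSet {n : ℕ} {p : Fin n → ℤ} {p₀ : ℤ} {x : Fin n → ℝ} :
    x ∈ splitSet p p₀ ↔ (p₀ : ℝ) < intVec p ⬝ᵥ x ∧ intVec p ⬝ᵥ x < (p₀ : ℝ) + 1 :=
  Iff.rfl

lemma notMem_splitSet {n : ℕ} {p : Fin n → ℤ} {p₀ : ℤ} {x : Fin n → ℝ} :
    x ∉ splitSet p p₀ ↔ intVec p ⬝ᵥ x ≤ p₀ ∨ (p₀ : ℝ) + 1 ≤ intVec p ⬝ᵥ x := by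
  rw [mem_splitSet, not_and_or, not_lt, not_lt]

lemma intVec_neg {ι : Type*} (v : ι → ℤ) : intVec (-v) = -intVec v := by
  ext i; simp [intVec]

/-- This symmetry exchanges the two sides of a split, so arguments need only treat the lower side,
or only `p₀ ≥ 0`. -/
lemma splitSet_neg {n : ℕ} (p : Fin n → ℤ) (p₀ : ℤ) :
    splitSet (-p) (-p₀ - 1) = splitSet p p₀ := by
  ext x
  rw [mem_splitSet, mem_splitSet, intVec_neg, neg_dotProduct]
  push_cast
  constructor <;> rintro ⟨h1, h2⟩ <;> constructor <;> linarith

lemma isUpperSet_coveringPolyhedron {m n : ℕ} {A : Matrix (Fin m) (Fin n) ℚ} {b : Fin m → ℚ}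
    (hA : ∀ i j, 0 ≤ A i j) : IsUpperSet (coveringPolyhedron A b) := fun x y hxy hx =>
  ⟨fun j => (hx.1 j).trans (hxy j), fun i => (hx.2 i).trans <| Finset.sum_le_sum fun j _ =>
    mul_le_mul_of_nonneg_left (hxy j) (by exact_mod_cast hA i j)⟩

lemma convex_coveringPolyhedron {m n : ℕ} (A : Matrix (Fin m) (Fin n) ℚ) (b : Fin m → ℚ) :
    Convex ℝ (coveringPolyhedron A b) := by
  intro x hx y hy s t hs ht hst
  refine ⟨fun j => add_nonneg (mul_nonneg hs (hx.1 j)) (mul_nonneg ht (hy.1 j)), fun i => ?_⟩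
  have : ∑ j, (A i j : ℝ) * (s • x + t • y) j =
      s * ∑ j, (A i j : ℝ) * x j + t * ∑ j, (A i j : ℝ) * y j := by
    rw [Finset.mul_sum, Finset.mul_sum, ← Finset.sum_add_distrib]
    refine Finset.sum_congr rfl fun j _ => ?_
    simp only [Pi.add_apply, Pi.smul_apply, smul_eq_mul]
    ring
  rw [this]
  calc (b i : ℝ) = s * b i + t * b i := by rw [← add_mul, hst, one_mul]
    _ ≤ _ := add_le_add (mul_le_mul_of_nonneg_left (hx.2 i) hs)
      (mul_le_mul_of_nonneg_left (hy.2 i) ht)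

/-- Removing a split set from an upper set and taking the convex hull gives an upper set. -/
theorem isUpperSet_convexHull_diff_splitSet {n : ℕ} {Q : Set (Fin n → ℝ)} (hQ : IsUpperSet Q)
    (p : Fin n → ℤ) (p₀ : ℤ) : IsUpperSet (convexHull ℝ (Q \ splitSet p p₀)) := by
  have base : ∀ x ∈ Q \ splitSet p p₀, ∀ d, 0 ≤ d → x + d ∈ convexHull ℝ (Q \ splitSet p p₀) := by
    intro x hx d hd
    by_cases hS : x + d ∈ splitSet p p₀
    -- If `x + d` falls inside the split, the ray from `x` is followed to the opposite boundary, at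
    -- parameter `s ≥ 1`; `x + d` lies between two points outside the split.
    · have key : ∀ c : ℝ, (c = p₀ ∨ c = p₀ + 1) → ∀ s : ℝ, 1 ≤ s →
          intVec p ⬝ᵥ (x + s • d) = c → x + d ∈ convexHull ℝ (Q \ splitSet p p₀) := by
        intro c hc s hs hsc
        have h0 : (0 : ℝ) < s := by linarith
        have hz : x + s • d ∈ Q \ splitSet p p₀ := by
          refine ⟨hQ (le_add_of_nonneg_right (smul_nonneg h0.le hd)) hx.1, ?_⟩
          rw [notMem_splitSet, hsc]
          exact hc.imp (fun h => h.le) (fun h => h.ge)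
        have := convex_convexHull ℝ (Q \ splitSet p p₀) (subset_convexHull ℝ _ hx)
          (subset_convexHull ℝ _ hz) (a := 1 - s⁻¹) (b := s⁻¹)
          (sub_nonneg.2 (inv_le_one_of_one_le₀ hs)) (inv_nonneg.2 h0.le) (by ring)
        convert this using 1
        rw [smul_add, smul_smul, inv_mul_cancel₀ h0.ne', one_smul, ← add_assoc, ← add_smul]
        simp
      rw [mem_splitSet, dotProduct_add] at hS
      simp only [dotProduct_add, dotProduct_smul, smul_eq_mul] at key
      rcases notMem_splitSet.1 hx.2 with h | h
      · have hpos : 0 < intVec p ⬝ᵥ d := by linarith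
        refine key _ (Or.inr rfl) ((p₀ + 1 - intVec p ⬝ᵥ x) / (intVec p ⬝ᵥ d)) ?_ ?_
        · rw [le_div_iff₀ hpos]; linarith
        · rw [div_mul_cancel₀ _ hpos.ne']; ring
      · have hneg : intVec p ⬝ᵥ d < 0 := by linarith
        refine key _ (Or.inl rfl) ((p₀ - intVec p ⬝ᵥ x) / (intVec p ⬝ᵥ d)) ?_ ?_
        · rw [le_div_iff_of_neg hneg]; linarith
        · rw [div_mul_cancel₀ _ hneg.ne]; ring
    · exact subset_convexHull ℝ _ ⟨hQ (le_add_of_nonneg_right hd) hx.1, hS⟩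
  intro x y hxy hx
  have hsub : Q \ splitSet p p₀ ⊆
      (fun z => z + (y - x)) ⁻¹' convexHull ℝ (Q \ splitSet p p₀) :=
    fun z hz => base z hz _ (sub_nonneg.2 hxy)
  have := convexHull_min hsub ((convex_convexHull ℝ _).translate_preimage_left (y - x)) hx
  simpa using this

/-- The cone over the covering polyhedron with data `(A, b)`; the first coordinate homogenizes. -/
def homCone {m n : ℕ} (A : Matrix (Fin m) (Fin n) ℚ) (b : Fin m → ℚ) : Set (Fin (n + 1) → ℝ) :=
  {z | (∀ i, 0 ≤ z i) ∧ ∀ i, (b i : ℝ) * z 0 ≤ ∑ j, (A i j : ℝ) * z j.succ}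

lemma vecCons_one_mem_homCone {m n : ℕ} {A : Matrix (Fin m) (Fin n) ℚ} {b : Fin m → ℚ}
    {x : Fin n → ℝ} : Matrix.vecCons 1 x ∈ homCone A b ↔ x ∈ coveringPolyhedron A b := by
  simp [homCone, coveringPolyhedron, Fin.forall_fin_succ]

lemma inv_smul_vecTail_mem {m n : ℕ} {A : Matrix (Fin m) (Fin n) ℚ} {b : Fin m → ℚ}
    {z : Fin (n + 1) → ℝ} (hz : z ∈ homCone A b) (h0 : 0 < z 0) :
    (z 0)⁻¹ • Matrix.vecTail z ∈ coveringPolyhedron A b := by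
  refine ⟨fun j => mul_nonneg (inv_nonneg.2 h0.le) (hz.1 _), fun i => ?_⟩
  have : ∑ j, (A i j : ℝ) * ((z 0)⁻¹ • Matrix.vecTail z) j =
      (∑ j, (A i j : ℝ) * z j.succ) / z 0 := by
    rw [Finset.sum_div]
    refine Finset.sum_congr rfl fun j _ => ?_
    simp only [Pi.smul_apply, smul_eq_mul, Matrix.vecTail, Function.comp]
    field_simp
  rw [this, le_div_iff₀ h0]
  exact hz.2 i

lemma smul_vecCons_one_inv_smul_vecTail {n : ℕ} {z : Fin (n + 1) → ℝ} (h0 : z 0 ≠ 0) :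
    z 0 • Matrix.vecCons 1 ((z 0)⁻¹ • Matrix.vecTail z) = z := by
  ext i
  refine Fin.cases ?_ (fun j => ?_) i
  · simp
  · simp [Matrix.vecTail, mul_inv_cancel_left₀ h0]

/-- Finitely many rationals have a common positive denominator. -/
lemma exists_pos_forall_mul_eq_int {ι : Type*} [Fintype ι] (q : ι → ℚ) :
    ∃ (D : ℚ) (v : ι → ℤ), 0 < D ∧ ∀ i, (v i : ℚ) = D * q i := by
  refine ⟨((∏ i, (q i).den : ℕ) : ℚ), fun i => ((∏ k, (q k).den : ℕ) : ℤ) / (q i).den * (q i).num,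
    by exact_mod_cast Finset.prod_pos fun i _ => (q i).den_pos, fun i => ?_⟩
  have hd : (((q i).den : ℤ)) ∣ ((∏ k, (q k).den : ℕ) : ℤ) := by
    exact_mod_cast Finset.dvd_prod_of_mem (fun k => (q k).den) (Finset.mem_univ i)
  have h0 : ((q i).den : ℚ) ≠ 0 := by exact_mod_cast (q i).den_nz
  obtain ⟨k, hk⟩ := hd
  have hk' : ((∏ k, (q k).den : ℕ) : ℚ) = (q i).den * k := by exact_mod_cast hk
  dsimp only
  rw [hk', hk, Int.mul_ediv_cancel_left _ (by exact_mod_cast (q i).den_nz)]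
  push_cast
  rw [← Rat.den_mul_eq_num]
  ring

lemma exists_intDual_eq_homCone {m n : ℕ} (A : Matrix (Fin m) (Fin n) ℚ) (b : Fin m → ℚ) :
    ∃ H : Set (Fin (n + 1) → ℤ), H.Finite ∧ intDual H = homCone A b := by
  choose D v hD hv using fun i => exists_pos_forall_mul_eq_int (Matrix.vecCons (-b i) (A i))
  refine ⟨Set.range (fun i => Pi.single i 1) ∪ Set.range v,
    (Set.finite_range _).union (Set.finite_range _), ?_⟩
  ext z
  have h1 : ∀ i, intVec (Pi.single i 1) ⬝ᵥ z = z i := fun i => by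
    have : intVec (Pi.single i 1 : Fin (n + 1) → ℤ) = Pi.single i 1 := by
      ext j; rcases eq_or_ne j i with rfl | h <;> simp [intVec, *]
    rw [this, single_one_dotProduct]
  have h2 : ∀ i, intVec (v i) ⬝ᵥ z =
      (D i : ℝ) * (∑ j, (A i j : ℝ) * z j.succ - b i * z 0) := fun i => by
    have hvr : ∀ k, (v i k : ℝ) = (D i : ℝ) * ((Matrix.vecCons (-b i) (A i) k : ℚ) : ℝ) := by
      intro k
      exact_mod_cast hv i k
    simp only [dotProduct, intVec, hvr, Fin.sum_univ_succ, Matrix.cons_val_zero,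
      Matrix.cons_val_succ, mul_sub, Finset.mul_sum, mul_assoc]
    push_cast
    ring
  simp only [intDual, homCone, Set.mem_ofPred_eq, Set.mem_union, or_imp, forall_and,
    Set.forall_mem_range, h1, h2]
  refine and_congr_right fun _ => forall_congr' fun i => ?_
  rw [mul_nonneg_iff_of_pos_left (by exact_mod_cast hD i), sub_nonneg]

/-- The homogenization of `x ↦ pᵀ x - p₀`. -/
def splitForm {n : ℕ} (p : Fin n → ℤ) (p₀ : ℤ) : Fin (n + 1) → ℤ := Matrix.vecCons (-p₀) p

lemma splitForm_dotProduct {n : ℕ} (p : Fin n → ℤ) (p₀ : ℤ) (z : Fin (n + 1) → ℝ) :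
    intVec (splitForm p p₀) ⬝ᵥ z = intVec p ⬝ᵥ Matrix.vecTail z - p₀ * z 0 := by
  simp [dotProduct, intVec, splitForm, Fin.sum_univ_succ, Matrix.vecTail]
  ring

lemma splitForm_dotProduct_smul_vecCons {n : ℕ} (p : Fin n → ℤ) (p₀ : ℤ) (t : ℝ) (x : Fin n → ℝ) :
    intVec (splitForm p p₀) ⬝ᵥ (t • Matrix.vecCons 1 x) = t * (intVec p ⬝ᵥ x - p₀) := by
  rw [dotProduct_smul, splitForm_dotProduct]
  simp

lemma inv_smul_vecTail_mem_diff {m n : ℕ} {A : Matrix (Fin m) (Fin n) ℚ} {b : Fin m → ℚ}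
    {p : Fin n → ℤ} {p₀ : ℤ} {z : Fin (n + 1) → ℝ} (hz : z ∈ homCone A b) (h0 : 0 < z 0)
    (h : intVec (splitForm p p₀) ⬝ᵥ z ≤ 0 ∨ z 0 ≤ intVec (splitForm p p₀) ⬝ᵥ z) :
    (z 0)⁻¹ • Matrix.vecTail z ∈ coveringPolyhedron A b \ splitSet p p₀ := by
  refine ⟨inv_smul_vecTail_mem hz h0, ?_⟩
  have e := splitForm_dotProduct_smul_vecCons p p₀ (z 0) ((z 0)⁻¹ • Matrix.vecTail z)
  rw [smul_vecCons_one_inv_smul_vecTail h0.ne'] at e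
  rw [notMem_splitSet]
  rw [e] at h
  refine h.imp (fun h => ?_) (fun h => ?_)
  · nlinarith
  · have := le_of_mul_le_mul_left ((mul_one _).trans_le h) h0
    linarith

/-- The hull of a covering polyhedron minus a split set is described by finitely many integer
covering inequalities. -/
theorem exists_convexHull_diff_splitSet_eq {m n : ℕ} {A : Matrix (Fin m) (Fin n) ℚ} {b : Fin m → ℚ}
    (hA : ∀ i j, 0 ≤ A i j) (p : Fin n → ℤ) (p₀ : ℤ) :
    ∃ H : Set (Fin (n + 1) → ℤ), H.Finite ∧ (∀ h ∈ H, ∀ j : Fin n, 0 ≤ h j.succ) ∧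
      ∀ x, x ∈ convexHull ℝ (coveringPolyhedron A b \ splitSet p p₀) ↔
        ∀ h ∈ H, 0 ≤ intVec h ⬝ᵥ Matrix.vecCons 1 x := by
  obtain ⟨H₀, hH₀, e₀⟩ := exists_intDual_eq_homCone A b
  obtain ⟨G₁, hG₁, e₁⟩ := exists_intCone_eq_intDual (hH₀.insert (-splitForm p p₀))
  obtain ⟨G₂, hG₂, e₂⟩ := exists_intCone_eq_intDual (hH₀.insert (splitForm p (p₀ + 1)))
  have m₁ : ∀ z, z ∈ intCone G₁ ↔ intVec (splitForm p p₀) ⬝ᵥ z ≤ 0 ∧ z ∈ homCone A b := by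
    intro z
    rw [← SetLike.mem_coe, e₁, ← e₀]
    simp [intDual, intVec_neg]
  have m₂ : ∀ z, z ∈ intCone G₂ ↔ z 0 ≤ intVec (splitForm p p₀) ⬝ᵥ z ∧ z ∈ homCone A b := by
    intro z
    rw [← SetLike.mem_coe, e₂, ← e₀]
    simp only [intDual, Set.forall_mem_insert, Set.mem_ofPred_eq, splitForm_dotProduct]
    refine and_congr_left fun _ => ?_
    push_cast
    constructor <;> intro h <;> linarith
  -- Generators in `E` force nonnegative coefficients on the functionals; they do not enlarge the
  -- hull, which is already an upper set.
  set E : Set (Fin (n + 1) → ℤ) := Set.range fun j : Fin n => Pi.single j.succ 1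
  obtain ⟨H, hH, e⟩ := exists_intDual_eq_intCone ((hG₁.union hG₂).union (Set.finite_range _ : E.Finite))
  have hmem : ∀ x, (∀ h ∈ H, 0 ≤ intVec h ⬝ᵥ Matrix.vecCons 1 x) ↔
      Matrix.vecCons 1 x ∈ intCone (G₁ ∪ G₂ ∪ E) := fun x => by
    rw [← SetLike.mem_coe, ← e]; rfl
  refine ⟨H, hH, fun h hh j => ?_, fun x => ?_⟩
  · have : intVec (Pi.single j.succ 1) ∈ intDual H := by
      rw [e]; exact intVec_mem_intCone (Or.inr ⟨j, rfl⟩)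
    have := this h hh
    rw [intVec_dotProduct_intVec, dotProduct_single_one] at this
    exact_mod_cast this
  rw [hmem]
  constructor
  · intro hx
    have hsub : coveringPolyhedron A b \ splitSet p p₀ ⊆
        {x | ∀ h ∈ H, 0 ≤ intVec h ⬝ᵥ Matrix.vecCons 1 x} := by
      intro y hy
      rw [Set.mem_ofPred_eq, hmem]
      have h1 : Matrix.vecCons 1 y ∈ homCone A b := vecCons_one_mem_homCone.2 hy.1
      have e3 := splitForm_dotProduct_smul_vecCons p p₀ 1 y
      rw [one_smul, one_mul] at e3
      rcases notMem_splitSet.1 hy.2 with h | h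
      · refine Submodule.span_mono (Set.image_mono (Set.subset_union_left.trans
          Set.subset_union_left)) ((m₁ _).2 ⟨?_, h1⟩)
        rw [e3]; linarith
      · refine Submodule.span_mono (Set.image_mono (Set.subset_union_right.trans
          Set.subset_union_left)) ((m₂ _).2 ⟨?_, h1⟩)
        rw [e3]; simp only [Matrix.cons_val_zero]; linarith
    rw [← hmem]
    refine convexHull_min hsub ?_ hx
    intro y hy z hz s t hs ht hst h hh
    have : Matrix.vecCons 1 (s • y + t • z) = s • Matrix.vecCons 1 y + t • Matrix.vecCons 1 z := by
      simp [hst]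
    rw [this, dotProduct_add, dotProduct_smul, dotProduct_smul]
    exact add_nonneg (mul_nonneg hs (hy h hh)) (mul_nonneg ht (hz h hh))
  · intro hx
    rw [intCone, Set.image_union, Set.image_union, Submodule.span_union, Submodule.span_union,
      Submodule.mem_sup] at hx
    obtain ⟨y, hy, d, hd, hyd⟩ := hx
    obtain ⟨z, hz, w, hw, rfl⟩ := Submodule.mem_sup.1 hy
    have hd0 : d 0 = 0 ∧ 0 ≤ d := by
      have hd' : d ∈ intCone E := hd
      have hc : ∀ i, 0 ≤ d i := fun i => by
        have := dotProduct_nonneg_of_mem_intCone (a := Pi.single i 1) (fun g hg => ?_) hd'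
        · simpa using this
        · obtain ⟨j, rfl⟩ := hg
          rw [single_one_dotProduct]
          rcases eq_or_ne i j.succ with rfl | h <;> simp [intVec, *]
      refine ⟨le_antisymm ?_ (hc 0), hc⟩
      have := dotProduct_nonneg_of_mem_intCone (a := -Pi.single 0 1) (fun g hg => ?_) hd'
      · simpa using this
      · obtain ⟨j, rfl⟩ := hg
        rw [neg_dotProduct, single_one_dotProduct]
        simp [intVec, Fin.succ_ne_zero]
    obtain ⟨hz1, hz2⟩ := (m₁ z).1 hz
    obtain ⟨hw1, hw2⟩ := (m₂ w).1 hw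
    have hsum : z 0 + w 0 = 1 := by
      have := congrFun hyd 0
      simpa [hd0.1] using this
    have hx : Matrix.vecTail z + Matrix.vecTail w ≤ x := by
      intro j
      have := congrFun hyd j.succ
      simp only [Pi.add_apply, Matrix.cons_val_succ] at this
      have := hd0.2 j.succ
      simp only [Pi.add_apply, Matrix.vecTail, Function.comp]
      simp only [Pi.zero_apply] at this
      linarith
    have hup := isUpperSet_convexHull_diff_splitSet (isUpperSet_coveringPolyhedron (b := b) hA) p p₀
    refine hup hx ?_
    have htz : 0 ≤ Matrix.vecTail z := fun j => hz2.1 _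
    have htw : 0 ≤ Matrix.vecTail w := fun j => hw2.1 _
    -- A summand with homogenizing coordinate zero is only a nonnegative direction, hence absorbed
    -- by the upper set. This is why the hull is closed even when one side contributes no point.
    rcases (hz2.1 0).lt_or_eq with h1 | h1
    · have a1 := subset_convexHull ℝ _ (inv_smul_vecTail_mem_diff hz2 h1 (Or.inl hz1))
      rcases (hw2.1 0).lt_or_eq with h2 | h2
      · have a2 := subset_convexHull ℝ _ (inv_smul_vecTail_mem_diff hw2 h2 (Or.inr hw1))
        have := convex_convexHull ℝ _ a1 a2 h1.le h2.le hsum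
        rwa [smul_smul, smul_smul, mul_inv_cancel₀ h1.ne', mul_inv_cancel₀ h2.ne', one_smul,
          one_smul] at this
      · have : z 0 = 1 := by linarith
        rw [this, inv_one, one_smul] at a1
        exact hup (le_add_of_nonneg_right htw) a1
    · have : w 0 = 1 := by linarith
      have a2 := subset_convexHull ℝ _ (inv_smul_vecTail_mem_diff hw2 (by linarith) (Or.inr hw1))
      rw [this, inv_one, one_smul] at a2
      exact hup (le_add_of_nonneg_left htz) a2

lemma intVec_nonneg_iff {ι : Type*} {v : ι → ℤ} {i : ι} : 0 ≤ intVec v i ↔ 0 ≤ v i := by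
  simp [intVec]

lemma intVec_le_intVec_iff {ι : Type*} {v w : ι → ℤ} {i : ι} :
    intVec v i ≤ intVec w i ↔ v i ≤ w i := by
  simp [intVec]

/-! ### Finitely many splits suffice -/

/-- Comparison data of a split at a generator with last coordinate `t` and split value `u`:
the componentwise order compares the depths of the split cuts along that generator. -/
def splitCode (t u : ℤ) : ℕ × ℕ × ℕ × ℕ :=
  ((-u).toNat, (u - t).toNat, (min u t).toNat, (min (t - u) t).toNat)

lemma splitCode_le_iff {t u v : ℤ} : splitCode t u ≤ splitCode t v ↔
    (-u).toNat ≤ (-v).toNat ∧ (u - t).toNat ≤ (v - t).toNat ∧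
      (min u t).toNat ≤ (min v t).toNat ∧ (min (t - u) t).toNat ≤ (min (t - v) t).toNat :=
  Iff.rfl

/-- The code treats both sides of the split alike: `u ↦ t - u` exchanges its entries in pairs. -/
lemma splitCode_sub_le {t u v : ℤ} (h : splitCode t u ≤ splitCode t v) :
    splitCode t (t - u) ≤ splitCode t (t - v) := by
  rw [splitCode_le_iff] at *
  omega

lemma splitForm_neg {n : ℕ} (p : Fin n → ℤ) (p₀ : ℤ) (z : Fin (n + 1) → ℤ) :
    splitForm (-p) (-p₀ - 1) ⬝ᵥ z = z 0 - splitForm p p₀ ⬝ᵥ z := by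
  simp [dotProduct, splitForm, Fin.sum_univ_succ]
  ring

section Dominance

variable {m n : ℕ} {A : Matrix (Fin m) (Fin n) ℚ} {b : Fin m → ℚ} {G : Set (Fin (n + 1) → ℤ)}

/-- A covering functional valid beside one split is valid on the lower side of any split with
smaller code at all generators. -/
lemma dotProduct_nonneg_of_splitCode_le (hG : G.Finite)
    (hGP : (intCone G : Set (Fin (n + 1) → ℝ)) = homCone A b) {s r : Fin (n + 1) → ℤ}
    (hsr : ∀ g ∈ G, splitCode (g 0) (s ⬝ᵥ g) ≤ splitCode (g 0) (r ⬝ᵥ g))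
    {h : Fin (n + 1) → ℝ} (hpos : ∀ j : Fin n, 0 ≤ h j.succ)
    (hval : ∀ z ∈ homCone A b, 0 < z 0 → (intVec r ⬝ᵥ z ≤ 0 ∨ z 0 ≤ intVec r ⬝ᵥ z) → 0 ≤ h ⬝ᵥ z)
    {z : Fin (n + 1) → ℝ} (hz : z ∈ homCone A b) (hsz : intVec s ⬝ᵥ z ≤ 0) : 0 ≤ h ⬝ᵥ z := by
  have hmem : ∀ g ∈ G, intVec g ∈ homCone A b := fun g hg => by
    rw [← hGP]; exact intVec_mem_intCone hg
  have hz' : z ∈ intCone G := by rw [← SetLike.mem_coe, hGP]; exact hz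
  have hg0 : ∀ g ∈ G, 0 ≤ g 0 := fun g hg => intVec_nonneg_iff.1 ((hmem g hg).1 0)
  have hout : ∀ g ∈ G, (g 0 = 0 ∨ r ⬝ᵥ g ≤ 0 ∨ g 0 ≤ r ⬝ᵥ g) → 0 ≤ h ⬝ᵥ intVec g := by
    intro g hg hc
    rcases (hg0 g hg).eq_or_lt with h0 | h0
    · rw [dotProduct, Fin.sum_univ_succ]
      have : intVec g 0 = 0 := by simp [intVec, ← h0]
      rw [this, mul_zero, zero_add]
      exact Finset.sum_nonneg fun j _ => mul_nonneg (hpos j) ((hmem g hg).1 _)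
    · refine hval _ (hmem g hg) (by simpa [intVec] using h0) ?_
      rw [intVec_dotProduct_intVec]
      simp only [intVec]
      exact_mod_cast hc.resolve_left h0.ne'
  by_cases hneg : ∃ g ∈ G, (0 < r ⬝ᵥ g ∧ r ⬝ᵥ g < g 0) ∧ h ⬝ᵥ intVec g < 0
  · obtain ⟨k, ⟨hkG, ⟨hk1, hk2⟩, hk3⟩, hmin⟩ := Set.exists_min_image
      {g ∈ G | (0 < r ⬝ᵥ g ∧ r ⬝ᵥ g < g 0) ∧ h ⬝ᵥ intVec g < 0}
      (fun g => h ⬝ᵥ intVec g / ((r ⬝ᵥ g : ℤ) : ℝ)) (hG.subset (Set.sep_subset _ _)) hneg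
    have hk1' : (0 : ℝ) < ((r ⬝ᵥ k : ℤ) : ℝ) := by exact_mod_cast hk1
    -- `M` is a Farkas multiplier: the largest ratio `-(h ⬝ᵥ g) / (r ⬝ᵥ g)` over generators inside
    -- the split where `h` is negative. Once `h + M • s` is nonnegative on the cone, `s ⬝ᵥ z ≤ 0`
    -- gives the claim.
    obtain ⟨M, hM⟩ : ∃ M : ℝ, M = -(h ⬝ᵥ intVec k / ((r ⬝ᵥ k : ℤ) : ℝ)) := ⟨_, rfl⟩
    have hM0 : 0 < M := by rw [hM]; exact neg_pos.2 (div_neg_of_neg_of_pos hk3 hk1')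
    have hMk : h ⬝ᵥ intVec k = -(M * ((r ⬝ᵥ k : ℤ) : ℝ)) := by
      rw [hM]; field_simp
    have hlow : ∀ g ∈ G, r ⬝ᵥ g < 0 → 0 ≤ h ⬝ᵥ intVec g + M * ((r ⬝ᵥ g : ℤ) : ℝ) := by
      intro g hg hgn
      have hgn' : ((r ⬝ᵥ g : ℤ) : ℝ) < 0 := by exact_mod_cast hgn
      -- This combination of `k` and `g` lies on the hyperplane `r = 0`, where `h` is known to be
      -- nonnegative.
      have hw : (-((r ⬝ᵥ g : ℤ) : ℝ)) • intVec k + ((r ⬝ᵥ k : ℤ) : ℝ) • intVec g ∈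
          homCone A b := by
        rw [← hGP]
        exact add_mem
          ((intCone G).smul_mem ⟨_, (neg_pos.2 hgn').le⟩ (intVec_mem_intCone hkG))
          ((intCone G).smul_mem ⟨_, hk1'.le⟩ (intVec_mem_intCone hg))
      have hkp : (0 : ℝ) < k 0 := by exact_mod_cast hk1.trans hk2
      have hgp : (0 : ℝ) ≤ g 0 := by exact_mod_cast hg0 g hg
      have := hval _ hw ?_ (Or.inl ?_)
      · rw [dotProduct_add, dotProduct_smul, dotProduct_smul, hMk, smul_eq_mul, smul_eq_mul] at this
        refine nonneg_of_mul_nonneg_right (a := ((r ⬝ᵥ k : ℤ) : ℝ)) ?_ hk1'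
        linarith
      · simp only [Pi.add_apply, Pi.smul_apply, smul_eq_mul, intVec]
        exact add_pos_of_pos_of_nonneg (mul_pos (neg_pos.2 hgn') hkp) (mul_nonneg hk1'.le hgp)
      · rw [dotProduct_add, dotProduct_smul, dotProduct_smul, intVec_dotProduct_intVec,
          intVec_dotProduct_intVec, smul_eq_mul, smul_eq_mul]
        linarith
    have hall : ∀ g ∈ G, 0 ≤ (h + M • intVec s) ⬝ᵥ intVec g := by
      intro g hg
      rw [add_dotProduct, smul_dotProduct, intVec_dotProduct_intVec, smul_eq_mul]
      -- The code order says: strictly inside the split, `s` and `r` agree at `g`; outside, `r` is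
      -- on the same side and at least as far out.
      have hc := splitCode_le_iff.1 (hsr g hg)
      have ht := hg0 g hg
      rcases lt_or_ge (s ⬝ᵥ g) 0 with hs | hs
      · have h1 : r ⬝ᵥ g < 0 := by omega
        have h2 : r ⬝ᵥ g ≤ s ⬝ᵥ g := by omega
        have h3 : ((r ⬝ᵥ g : ℤ) : ℝ) ≤ ((s ⬝ᵥ g : ℤ) : ℝ) := by exact_mod_cast h2
        have := hlow g hg h1
        nlinarith
      · have hs' : (0 : ℝ) ≤ ((s ⬝ᵥ g : ℤ) : ℝ) := by exact_mod_cast hs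
        by_cases hin : 0 < s ⬝ᵥ g ∧ s ⬝ᵥ g < g 0
        · have he : s ⬝ᵥ g = r ⬝ᵥ g := by omega
          rw [he] at hin hs' ⊢
          by_cases hh : h ⬝ᵥ intVec g < 0
          · have := hmin g ⟨hg, hin, hh⟩
            have hr : (0 : ℝ) < ((r ⬝ᵥ g : ℤ) : ℝ) := by exact_mod_cast hin.1
            rw [le_div_iff₀ hr] at this
            rw [hM]
            linarith
          · exact add_nonneg (not_lt.1 hh) (mul_nonneg hM0.le hs')
        · exact add_nonneg (hout g hg (by omega)) (mul_nonneg hM0.le hs')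
    have := dotProduct_nonneg_of_mem_intCone hall hz'
    rw [add_dotProduct, smul_dotProduct, smul_eq_mul] at this
    nlinarith
  · push Not at hneg
    refine dotProduct_nonneg_of_mem_intCone (fun g hg => ?_) hz'
    by_cases hin : 0 < r ⬝ᵥ g ∧ r ⬝ᵥ g < g 0
    · exact hneg g hg hin
    · exact hout g hg (by omega)

lemma convexHull_diff_splitSet_subset (hA : ∀ i j, 0 ≤ A i j) (hG : G.Finite)
    (hGP : (intCone G : Set (Fin (n + 1) → ℝ)) = homCone A b) {p q : Fin n → ℤ} {p₀ q₀ : ℤ}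
    (hpq : ∀ g ∈ G, splitCode (g 0) (splitForm p p₀ ⬝ᵥ g) ≤ splitCode (g 0) (splitForm q q₀ ⬝ᵥ g)) :
    convexHull ℝ (coveringPolyhedron A b \ splitSet p p₀) ⊆
      convexHull ℝ (coveringPolyhedron A b \ splitSet q q₀) := by
  refine convexHull_min (fun x hx => ?_) (convex_convexHull ℝ _)
  have key : ∀ (p q : Fin n → ℤ) (p₀ q₀ : ℤ), (∀ g ∈ G, splitCode (g 0) (splitForm p p₀ ⬝ᵥ g) ≤
      splitCode (g 0) (splitForm q q₀ ⬝ᵥ g)) → intVec p ⬝ᵥ x ≤ p₀ →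
      x ∈ convexHull ℝ (coveringPolyhedron A b \ splitSet q q₀) := by
    intro p q p₀ q₀ hpq hxp
    obtain ⟨H, -, hH, hmem⟩ := exists_convexHull_diff_splitSet_eq (b := b) hA q q₀
    rw [hmem]
    intro h hh
    refine dotProduct_nonneg_of_splitCode_le hG hGP hpq
      (fun j => intVec_nonneg_iff.2 (hH h hh j)) ?_ (vecCons_one_mem_homCone.2 hx.1) ?_
    · intro z hz h0 hzq
      have := (hmem _).1 (subset_convexHull ℝ _ (inv_smul_vecTail_mem_diff hz h0 hzq)) h hh
      rw [← smul_vecCons_one_inv_smul_vecTail h0.ne', dotProduct_smul]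
      exact mul_nonneg h0.le this
    · have := splitForm_dotProduct_smul_vecCons p p₀ 1 x
      rw [one_smul, one_mul] at this
      rw [this]
      linarith
  rcases notMem_splitSet.1 hx.2 with h | h
  · exact key p q p₀ q₀ hpq h
  · rw [← splitSet_neg]
    refine key (-p) (-q) (-p₀ - 1) (-q₀ - 1) (fun g hg => ?_) ?_
    · rw [splitForm_neg, splitForm_neg]
      exact splitCode_sub_le (hpq g hg)
    · rw [intVec_neg, neg_dotProduct]
      push_cast
      linarith

variable (b) in
/-- The split closure of a covering polyhedron is determined by finitely many splits. -/
theorem exists_finite_splits (hA : ∀ i j, 0 ≤ A i j) :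
    ∃ T : Set ((Fin n → ℤ) × ℤ), T.Finite ∧ ∀ p p₀, ∃ t ∈ T,
      convexHull ℝ (coveringPolyhedron A b \ splitSet t.1 t.2) ⊆
        convexHull ℝ (coveringPolyhedron A b \ splitSet p p₀) := by
  obtain ⟨H, hH, hHP⟩ := exists_intDual_eq_homCone A b
  obtain ⟨G, hG, hGH⟩ := exists_intCone_eq_intDual hH
  -- Finiteness of `G` makes the functions from `G` to codes well-quasi-ordered.
  have := hG.to_subtype
  obtain ⟨T, hT, h⟩ := exists_finite_forall_exists_le (fun (t : (Fin n → ℤ) × ℤ) (g : G) =>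
    splitCode (g.1 0) (splitForm t.1 t.2 ⬝ᵥ g.1))
  refine ⟨T, hT, fun p p₀ => ?_⟩
  obtain ⟨t, ht, hle⟩ := h (p, p₀)
  exact ⟨t, ht, convexHull_diff_splitSet_subset hA hG (hGH.trans hHP) fun g hg => hle ⟨g, hg⟩⟩

end Dominance

/-! ### Clipping coefficients -/

/-- The vector `x` with the coordinates in `J` set to zero. -/
def offCoords {n : ℕ} (J : Finset (Fin n)) (x : Fin n → ℝ) : Fin n → ℝ :=
  fun j => if j ∈ J then 0 else x j

lemma dotProduct_eq_sum_add_offCoords {n : ℕ} (J : Finset (Fin n)) (c x : Fin n → ℝ) :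
    c ⬝ᵥ x = ∑ j ∈ J, c j * x j + c ⬝ᵥ offCoords J x := by
  rw [dotProduct, ← Finset.sum_filter_add_sum_filter_not Finset.univ (· ∈ J)]
  congr 1
  · simp
  · rw [Finset.sum_filter]
    refine Finset.sum_congr rfl fun j _ => ?_
    by_cases h : j ∈ J <;> simp [offCoords, h]

section WellBehaved

variable {m n : ℕ} {A : Matrix (Fin m) (Fin n) ℚ} {b : Fin m → ℚ}

/-- In a well-behaved covering polyhedron, coordinates of total size `s < 1` may be dropped when
the point is rescaled by `1 / (1 - s)`. -/
lemma inv_smul_offCoords_mem (hAb : ∀ i j, A i j ≤ b i) {x : Fin n → ℝ}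
    (hx : x ∈ coveringPolyhedron A b) (J : Finset (Fin n)) (hs : ∑ j ∈ J, x j < 1) :
    (1 - ∑ j ∈ J, x j)⁻¹ • offCoords J x ∈ coveringPolyhedron A b := by
  have h0 : 0 < 1 - ∑ j ∈ J, x j := by linarith
  refine ⟨fun j => mul_nonneg (inv_nonneg.2 h0.le) ?_, fun i => ?_⟩
  · by_cases h : j ∈ J <;> simp [offCoords, h, hx.1 j]
  · change (b i : ℝ) ≤ (fun j => (A i j : ℝ)) ⬝ᵥ _
    rw [dotProduct_smul, smul_eq_mul, inv_mul_eq_div, le_div_iff₀ h0]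
    have h1 : (b i : ℝ) ≤ (fun j => (A i j : ℝ)) ⬝ᵥ x := hx.2 i
    rw [dotProduct_eq_sum_add_offCoords J] at h1
    have h2 : ∑ j ∈ J, (A i j : ℝ) * x j ≤ b i * ∑ j ∈ J, x j := by
      rw [Finset.mul_sum]
      exact Finset.sum_le_sum fun j _ =>
        mul_le_mul_of_nonneg_right (by exact_mod_cast hAb i j) (hx.1 j)
    linarith

lemma convex_setOf_le_dotProduct {n : ℕ} (c : Fin n → ℝ) (r : ℝ) :
    Convex ℝ {x | r ≤ c ⬝ᵥ x} :=
  convex_halfSpace_ge ⟨dotProduct_add c, fun t x => dotProduct_smul t c x⟩ r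

lemma splitClosure_subset_convexHull {n : ℕ} (Q : Set (Fin n → ℝ)) (p : Fin n → ℤ) (p₀ : ℤ) :
    splitClosure Q ⊆ convexHull ℝ (Q \ splitSet p p₀) :=
  fun _ hx => Set.mem_iInter₂.1 hx p p₀

/-- A split cut of a well-behaved covering polyhedron may be clipped: the result is again valid for
the split closure. -/
theorem le_min_dotProduct_of_mem_splitClosure (hAb : ∀ i j, A i j ≤ b i)
    {p : Fin n → ℤ} {p₀ : ℤ} {a : Fin n → ℤ} {β : ℤ} (ha : ∀ j, 0 ≤ a j) (hβ : 0 ≤ β)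
    (hval : ∀ x ∈ coveringPolyhedron A b \ splitSet p p₀, (β : ℝ) ≤ intVec a ⬝ᵥ x)
    {x : Fin n → ℝ} (hx : x ∈ splitClosure (coveringPolyhedron A b)) :
    (β : ℝ) ≤ intVec (fun j => min (a j) β) ⬝ᵥ x := by
  set J : Finset (Fin n) := {j | β < a j} with hJ
  -- With `p₀ + 1` on `J`, dropping `J` and rescaling sends points outside the new split to points
  -- outside the old one: the upper bound becomes exactly `(p₀ + 1) * (1 - s)`, and the lower one
  -- has slack `s`.
  set q : Fin n → ℤ := fun j => if j ∈ J then p₀ + 1 else p j with hq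
  refine convexHull_min (s := coveringPolyhedron A b \ splitSet q p₀) (fun w hw => ?_)
    (convex_setOf_le_dotProduct _ _) (splitClosure_subset_convexHull _ q p₀ hx)
  have hoff : ∀ j, 0 ≤ offCoords J w j := fun j => by
    by_cases h : j ∈ J <;> simp [offCoords, h, hw.1.1 j]
  have e1 : intVec (fun j => min (a j) β) ⬝ᵥ w =
      β * ∑ j ∈ J, w j + intVec a ⬝ᵥ offCoords J w := by
    rw [dotProduct_eq_sum_add_offCoords J, Finset.mul_sum]
    congr 1
    · refine Finset.sum_congr rfl fun j hj => ?_
      have : β < a j := by simpa [hJ] using hj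
      simp [intVec, min_eq_right this.le]
    · refine Finset.sum_congr rfl fun j _ => ?_
      by_cases h : j ∈ J
      · simp [offCoords, h]
      · have : a j ≤ β := by simpa [hJ] using h
        simp [intVec, min_eq_left this]
  have e2 : intVec q ⬝ᵥ w = (p₀ + 1) * ∑ j ∈ J, w j + intVec p ⬝ᵥ offCoords J w := by
    rw [dotProduct_eq_sum_add_offCoords J, Finset.mul_sum]
    congr 1
    · exact Finset.sum_congr rfl fun j hj => by simp [intVec, hq, hj]
    · refine Finset.sum_congr rfl fun j _ => ?_
      by_cases h : j ∈ J <;> simp [offCoords, intVec, hq, h]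
  have hβ' : (0 : ℝ) ≤ β := by exact_mod_cast hβ
  have hs0 : 0 ≤ ∑ j ∈ J, w j := Finset.sum_nonneg fun j _ => hw.1.1 j
  have ha0 : 0 ≤ intVec a ⬝ᵥ offCoords J w :=
    Finset.sum_nonneg fun j _ => mul_nonneg (intVec_nonneg_iff.2 (ha j)) (hoff j)
  rw [Set.mem_ofPred_eq, e1]
  rcases le_or_gt 1 (∑ j ∈ J, w j) with hs | hs
  · nlinarith
  · have h0 : 0 < 1 - ∑ j ∈ J, w j := by linarith
    have hy := hval _ ⟨inv_smul_offCoords_mem hAb hw.1 J hs, ?_⟩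
    · rw [dotProduct_smul, smul_eq_mul, inv_mul_eq_div, le_div_iff₀ h0] at hy
      linarith
    · have hw2 := hw.2
      rw [notMem_splitSet, e2] at hw2
      rw [notMem_splitSet, dotProduct_smul, smul_eq_mul, inv_mul_eq_div, div_le_iff₀ h0,
        le_div_iff₀ h0]
      refine hw2.imp (fun h => ?_) (fun h => ?_) <;> nlinarith

/-- The split closure of a well-behaved covering polyhedron is a well-behaved covering
polyhedron. -/
theorem isWellBehavedCovering_splitClosure (hA : ∀ i j, 0 ≤ A i j)
    (hAb : ∀ i j, A i j ≤ b i) :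
    IsWellBehavedCovering (splitClosure (coveringPolyhedron A b)) := by
  choose H hHfin hHpos hH using fun t : (Fin n → ℤ) × ℤ =>
    exists_convexHull_diff_splitSet_eq (b := b) hA t.1 t.2
  obtain ⟨T, hT, hdom⟩ := exists_finite_splits b hA
  obtain ⟨k, f, -, hf⟩ := (hT.biUnion fun t _ => hHfin t).fin_param
  have hfmem : ∀ i, ∃ t ∈ T, f i ∈ H t := fun i => by
    have : f i ∈ ⋃ t ∈ T, H t := hf ▸ Set.mem_range_self i
    simpa using this
  have hfpos : ∀ i (j : Fin n), 0 ≤ f i j.succ := fun i j => by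
    obtain ⟨t, -, ht⟩ := hfmem i
    exact hHpos t _ ht j
  have hform : ∀ (h : Fin (n + 1) → ℤ) (x : Fin n → ℝ),
      intVec h ⬝ᵥ Matrix.vecCons 1 x = intVec (fun j : Fin n => h j.succ) ⬝ᵥ x + h 0 := by
    intro h x
    simp [dotProduct, Fin.sum_univ_succ, intVec, add_comm]
  -- Raising a negative right-hand side to `0` is harmless, as the coefficients and `x` are
  -- nonnegative.
  refine ⟨k, fun i j => ((min (f i j.succ) (max (-f i 0) 0) : ℤ) : ℚ),
    fun i => ((max (-f i 0) 0 : ℤ) : ℚ), fun i j => ?_, fun i => ?_, fun i j => ?_, ?_⟩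
  · exact Int.cast_nonneg (le_min (hfpos i j) (le_max_right _ _))
  · exact Int.cast_nonneg (le_max_right _ _)
  · exact Int.cast_le.2 (min_le_right _ _)
  ext x
  have hcov : x ∈ coveringPolyhedron
      (fun (i : Fin k) (j : Fin n) => ((min (f i j.succ) (max (-f i 0) 0) : ℤ) : ℚ))
      (fun i => ((max (-f i 0) 0 : ℤ) : ℚ)) ↔ (∀ j, 0 ≤ x j) ∧
        ∀ i, ((max (-f i 0) 0 : ℤ) : ℝ) ≤
          intVec (fun j : Fin n => min (f i j.succ) (max (-f i 0) 0)) ⬝ᵥ x := by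
    simp only [coveringPolyhedron, Set.mem_ofPred_eq, Rat.cast_intCast]
    rfl
  rw [hcov]
  constructor
  · intro hx
    refine ⟨?_, fun i => ?_⟩
    · exact (convexHull_min Set.sdiff_subset (convex_coveringPolyhedron A b)
        (splitClosure_subset_convexHull _ 0 0 hx)).1
    · obtain ⟨t, -, ht⟩ := hfmem i
      refine le_min_dotProduct_of_mem_splitClosure hAb (p := t.1) (p₀ := t.2) (hfpos i)
        (le_max_right _ _) (fun y hy => ?_) hx
      have h1 := (hH t y).1 (subset_convexHull ℝ _ hy) _ ht
      rw [hform] at h1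
      push_cast
      refine max_le (by linarith) (Finset.sum_nonneg fun j _ => mul_nonneg
        (intVec_nonneg_iff.2 (hfpos i j)) (hy.1.1 j))
  · rintro ⟨hx0, hx⟩
    refine Set.mem_iInter₂.2 fun p p₀ => ?_
    obtain ⟨t, ht, hsub⟩ := hdom p p₀
    refine hsub ((hH t x).2 fun h hh => ?_)
    obtain ⟨i, rfl⟩ : h ∈ Set.range f := by rw [hf]; exact Set.mem_biUnion ht hh
    rw [hform]
    have h1 := hx i
    have h2 : intVec (fun j : Fin n => min (f i j.succ) (max (-f i 0) 0)) ⬝ᵥ x ≤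
        intVec (fun j : Fin n => f i j.succ) ⬝ᵥ x :=
      Finset.sum_le_sum fun j _ => mul_le_mul_of_nonneg_right
        (intVec_le_intVec_iff.2 (min_le_left _ _)) (hx0 j)
    have h3 : (-(f i 0) : ℝ) ≤ ((max (-f i 0) 0 : ℤ) : ℝ) := by exact_mod_cast le_max_left _ _
    linarith

end WellBehaved

/-! ### The factor two -/

section Factor

variable {m n : ℕ} {A : Matrix (Fin m) (Fin n) ℚ} {b : Fin m → ℚ}

lemma two_smul_mem_convexHull_of_nonneg (hA : ∀ i j, 0 ≤ A i j) (hAb : ∀ i j, A i j ≤ b i)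
    {x : Fin n → ℝ} (hx : x ∈ coveringPolyhedron A b) {p : Fin n → ℤ} {p₀ : ℤ} (hp₀ : 0 ≤ p₀) :
    (2 : ℝ) • x ∈ convexHull ℝ (coveringPolyhedron A b \ splitSet p p₀) := by
  have hP := isUpperSet_coveringPolyhedron (b := b) hA
  have hup := isUpperSet_convexHull_diff_splitSet hP p p₀
  have hx2 : x ≤ (2 : ℝ) • x := fun j => by
    have := hx.1 j
    simp only [Pi.smul_apply, smul_eq_mul]
    linarith
  by_cases hS : x ∈ splitSet p p₀
  swap
  · exact hup hx2 (subset_convexHull ℝ _ ⟨hx, hS⟩)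
  by_cases hS2 : (2 : ℝ) • x ∈ splitSet p p₀
  swap
  · exact subset_convexHull ℝ _ ⟨hP hx2 hx, hS2⟩
  rw [mem_splitSet] at hS hS2
  rw [dotProduct_smul, smul_eq_mul] at hS2
  -- `p₀ < p ⬝ᵥ x` and `2 (p ⬝ᵥ x) < p₀ + 1` leave only `p₀ = 0`, with `p ⬝ᵥ x < 1/2`.
  obtain rfl : p₀ = 0 := by
    have : (p₀ : ℝ) < 1 := by linarith
    have : p₀ < 1 := by exact_mod_cast this
    omega
  simp only [Int.cast_zero, zero_add] at hS hS2
  set J : Finset (Fin n) := {j | 0 < p j} with hJ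
  set s := ∑ j ∈ J, x j with hs
  have hoff : 0 ≤ offCoords J x := fun j => by
    by_cases h : j ∈ J <;> simp [offCoords, h, hx.1 j]
  have hoffx : offCoords J x ≤ x := fun j => by
    by_cases h : j ∈ J <;> simp [offCoords, h, hx.1 j]
  have hpoff : intVec p ⬝ᵥ offCoords J x ≤ 0 := by
    refine Finset.sum_nonpos fun j _ => ?_
    by_cases h : j ∈ J
    · simp [offCoords, h]
    · have : p j ≤ 0 := by simpa [hJ] using h
      exact mul_nonpos_of_nonpos_of_nonneg (by simpa [intVec] using this) (hoff j)
  have hdecomp := dotProduct_eq_sum_add_offCoords J (intVec p) x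
  have hsum : s ≤ ∑ j ∈ J, intVec p j * x j := by
    refine Finset.sum_le_sum fun j hj => le_mul_of_one_le_left (hx.1 j) ?_
    have : 0 < p j := by simpa [hJ] using hj
    simp only [intVec]
    exact_mod_cast this
  rcases lt_or_ge s 1 with h1 | h1
  · have hs0 : 0 < s := by
      by_contra hneg
      have hz : ∀ j ∈ J, x j = 0 := by
        refine (Finset.sum_eq_zero_iff_of_nonneg fun j _ => hx.1 j).1 ?_
        exact le_antisymm (not_lt.1 hneg) (Finset.sum_nonneg fun j _ => hx.1 j)
      rw [Finset.sum_eq_zero fun j hj => by rw [hz j hj, mul_zero]] at hdecomp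
      linarith
    have h1s : 0 < 1 - s := by linarith
    have hy : (1 - s)⁻¹ • offCoords J x ∈ coveringPolyhedron A b \ splitSet p 0 := by
      refine ⟨inv_smul_offCoords_mem hAb hx J h1, notMem_splitSet.2 (Or.inl ?_)⟩
      rw [dotProduct_smul, smul_eq_mul, Int.cast_zero]
      exact mul_nonpos_of_nonneg_of_nonpos (inv_nonneg.2 h1s.le) hpoff
    have hw : x + s⁻¹ • (x - offCoords J x) ∈ coveringPolyhedron A b \ splitSet p 0 := by
      refine ⟨hP (le_add_of_nonneg_right (smul_nonneg (inv_nonneg.2 hs0.le)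
        (sub_nonneg.2 hoffx))) hx, notMem_splitSet.2 (Or.inr ?_)⟩
      rw [dotProduct_add, dotProduct_smul, dotProduct_sub, smul_eq_mul, Int.cast_zero, zero_add]
      have : 1 ≤ s⁻¹ * (intVec p ⬝ᵥ x - intVec p ⬝ᵥ offCoords J x) := by
        rw [inv_mul_eq_div, le_div_iff₀ hs0]
        linarith
      linarith
    -- With weights `1 - s` and `s` the combination is exactly `(1 + s) x`, which is below `2x`.
    have hmem := convex_convexHull ℝ _ (subset_convexHull ℝ _ hy) (subset_convexHull ℝ _ hw)
      h1s.le hs0.le (by ring)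
    refine hup (fun j => ?_) hmem
    have hxj := hx.1 j
    have e : ((1 - s) • (1 - s)⁻¹ • offCoords J x + s • (x + s⁻¹ • (x - offCoords J x))) j =
        (1 + s) * x j := by
      simp only [Pi.add_apply, Pi.smul_apply, Pi.sub_apply, smul_eq_mul]
      rw [mul_inv_cancel_left₀ h1s.ne', mul_add, mul_inv_cancel_left₀ hs0.ne']
      ring
    rw [e, Pi.smul_apply, smul_eq_mul]
    nlinarith
  -- Here the positive part of `p ⬝ᵥ x` is at least `1`, so counting the remaining coordinates twice
  -- gives a value at most `2 (p ⬝ᵥ x) - 1 < 0`.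
  · have hy : x + offCoords J x ∈ coveringPolyhedron A b \ splitSet p 0 := by
      refine ⟨hP (le_add_of_nonneg_right hoff) hx, notMem_splitSet.2 (Or.inl ?_)⟩
      rw [dotProduct_add, Int.cast_zero]
      linarith
    refine hup ?_ (subset_convexHull ℝ _ hy)
    rw [two_smul]
    exact add_le_add_right hoffx x

/-- Doubling a well-behaved covering polyhedron moves it into its split closure. -/
theorem two_smul_subset_splitClosure (hA : ∀ i j, 0 ≤ A i j) (hAb : ∀ i j, A i j ≤ b i) :
    (2 : ℝ) • coveringPolyhedron A b ⊆ splitClosure (coveringPolyhedron A b) := by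
  rintro _ ⟨x, hx, rfl⟩
  refine Set.mem_iInter₂.2 fun p p₀ => ?_
  rcases le_or_gt 0 p₀ with h | h
  · exact two_smul_mem_convexHull_of_nonneg hA hAb hx h
  · rw [← splitSet_neg]
    exact two_smul_mem_convexHull_of_nonneg hA hAb hx (by omega)

end Factor

/-! ### Tightness of the factor two -/

/-- The covering polyhedron given by `∑_{j ≠ i} x_j ≥ 1` for all `i` needs a factor close to two. -/
theorem not_smul_subset_splitClosure {k : ℕ} {ε : ℝ} (hε : 0 < ε) (hk : 2 < ε * k) :
    ¬ ((2 - ε) • coveringPolyhedron (fun i j : Fin (k + 2) => if i = j then (0 : ℚ) else 1) 1 ⊆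
      splitClosure
        (coveringPolyhedron (fun i j : Fin (k + 2) => if i = j then (0 : ℚ) else 1) 1)) := by
  intro hsub
  have hmem : ∀ x : Fin (k + 2) → ℝ,
      x ∈ coveringPolyhedron (fun i j : Fin (k + 2) => if i = j then (0 : ℚ) else 1) 1 ↔
        (∀ j, 0 ≤ x j) ∧ ∀ i, 1 ≤ ∑ j, x j - x i := by
    intro x
    have : ∀ i, ∑ j, ((if i = j then (0 : ℚ) else 1 : ℚ) : ℝ) * x j = ∑ j, x j - x i := by
      intro i
      have hi : ∑ j, (if i = j then x j else 0) = x i := by simp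
      rw [eq_sub_iff_add_eq, ← hi, ← Finset.sum_add_distrib]
      refine Finset.sum_congr rfl fun j _ => ?_
      split_ifs <;> simp
    simp [coveringPolyhedron, this]
  have hone : ∀ x : Fin (k + 2) → ℝ, intVec (1 : Fin (k + 2) → ℤ) ⬝ᵥ x = ∑ j, x j := by
    intro x
    simp [intVec, dotProduct]
  have hk1 : (0 : ℝ) < k + 1 := by positivity
  have hx := hsub (Set.smul_mem_smul_set ((hmem fun _ => ((k : ℝ) + 1)⁻¹).2
    ⟨fun _ => inv_nonneg.2 hk1.le, fun _ => by simp; field_simp; linarith⟩))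
  -- The side `∑ y_j ≤ 1` is empty, since it would force every `y_i ≤ 0`; so the sum is at least `2`
  -- on the hull.
  have h2 : (2 : ℝ) ≤ intVec (1 : Fin (k + 2) → ℤ) ⬝ᵥ ((2 - ε) • fun _ => ((k : ℝ) + 1)⁻¹) := by
    refine convexHull_min (fun y hy => ?_) (convex_setOf_le_dotProduct _ 2)
      (splitClosure_subset_convexHull _ 1 1 hx)
    have hy1 := (hmem y).1 hy.1
    rw [Set.mem_ofPred_eq]
    rcases notMem_splitSet.1 hy.2 with h | h
    · rw [hone, Int.cast_one] at h
      have hle : ∑ j, y j ≤ 0 := Finset.sum_nonpos fun i _ => by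
        have := hy1.2 i
        linarith
      have := hy1.2 0
      have := hy1.1 0
      linarith
    · rw [Int.cast_one] at h
      linarith
  rw [dotProduct_smul, hone, Finset.sum_const, Finset.card_univ, Fintype.card_fin, nsmul_eq_mul,
    smul_eq_mul, ← mul_assoc, ← div_eq_mul_inv, le_div_iff₀ hk1] at h2
  push_cast at h2
  nlinarith

theorem mainTheorem3 :
    (∀ (n : ℕ) (P : Set (Fin n → ℝ)), IsWellBehavedCovering P →
      IsWellBehavedCovering (splitClosure P) ∧ (2 : ℝ) • P ⊆ splitClosure P) ∧
    (∀ ε : ℝ, 0 < ε → ∃ (n : ℕ) (P : Set (Fin n → ℝ)),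
      IsWellBehavedCovering P ∧ ¬ ((2 - ε) • P ⊆ splitClosure P)) := by
  constructor
  · rintro n P ⟨m, A, b, hA, -, hAb, rfl⟩
    exact ⟨isWellBehavedCovering_splitClosure hA hAb, two_smul_subset_splitClosure hA hAb⟩
  · intro ε hε
    obtain ⟨k, hk⟩ := exists_nat_gt (2 / ε)
    refine ⟨k + 2, _, ⟨k + 2, fun i j => if i = j then 0 else 1, 1, fun i j => ?_,
      fun _ => zero_le_one, fun i j => ?_, rfl⟩,
      not_smul_subset_splitClosure hε (by rwa [div_lt_iff₀' hε] at hk)⟩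
    · dsimp only; split_ifs <;> norm_num
    · dsimp only; split_ifs <;> norm_num
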